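/- Let $R$ be a commutative ring with $1$, let $M$ be a simple matroid of rank $\ell$ on $[n]=\{1,\dots,n\}$ (no loops and no two distinct parallel elements), and let $E$ be the exterior algebra over $R$ of the free module $V$ with basis $e_1,\dots,e_n$. Let $\partial:E\to E$ be the $R$-linear map of degree $-1$ with $\partial e_i=1$ for all $i$ and $\partial(ab)=(\partial a)b+(-1)^{\deg a}a\,\partial b$ for homogeneous $a$ and all $b\in E$. For $S=\{i_1<\dots<i_p\}\subseteq[n]$ put $e_S=e_{i_1}\cdots e_{i_p}$. The Orlik–Solomon (OS) ideal $I$ of $M$ is the ideal of $E$ generated by $\partial e_S$ for all dependent sets $S$ of $M$. A broken circuit is a circuit of $M$ with its smallest element deleted, and $\mathbf{nbc}_\ell$ denotes the collection of subsets of $[n]$ of cardinality $\ell$ that contain no broken circuit. For $T=\{i_1<\dots<i_\ell\}\in\mathbf{nbc}_\ell$ put $X_p=\mathrm{cl}(\{i_{\ell-p+1},\dots,i_\ell\})$ for $0\le p\le\ell$, so that $\emptyset=X_0\subset X_1\subset\dots\subset X_\ell=[n]$ is a maximal flag of flats; let $\pi(T)$ be the partition of $[n]$ into the sets $X_p\setminus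 X_{p-1}$, $1\le p\le\ell$, let $\nu(A)=\min A$ for $A\in\pi(T)$, and let $I_T$ be the ideal of $E$ generated by the degree one elements $e_i-e_{\nu(A)}$ for all $A\in\pi(T)$ and $i\in A\setminus\{\nu(A)\}$ (these are the linear factors of $z(T)=\pm\prod_{A\in\pi(T)}\partial e_A$). Then the OS ideal is the intersection of these linear ideals: $$I=\bigcap_{T\in\mathbf{nbc}_\ell} I_T.$$ -/

import Mathlib

open scoped ExteriorAlgebra

noncomputable section

namespace OrlikSolomon

/-- A matroid is simple if it has no loops (the case `i = j`) and no two distinct parallel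
elements. -/
def IsSimple {n : ℕ} (M : Matroid (Fin n)) : Prop :=
  ∀ i ∈ M.E, ∀ j ∈ M.E, M.Indep {i, j}

/-- The exterior algebra `E` of the free `R`-module `V = Rⁿ`. -/
abbrev E (R : Type*) [CommRing R] (n : ℕ) : Type _ := ExteriorAlgebra R (Fin n → R)

/-- The generator `e_i` of the exterior algebra. -/
def gen (R : Type*) [CommRing R] {n : ℕ} (i : Fin n) : E R n := ExteriorAlgebra.ι R (Pi.single i 1 : Fin n → R)

/-- The monomial `e_S = e_{i₁} e_{i₂} ⋯ e_{iₚ}` for `S = {i₁ < i₂ < ⋯ < iₚ}`. -/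
def monomial (R : Type*) [CommRing R] {n : ℕ} (S : Finset (Fin n)) : E R n := (S.sort.map (gen R)).prod

/-- The differential `∂` of `E`: the contraction with the linear form `∑ i, e_i^*`. It is the
unique `R`-linear map that satisfies `∂ e_i = 1` and the graded Leibniz rule. -/
def boundary (R : Type*) [CommRing R] {n : ℕ} : E R n →ₗ[R] E R n :=
  CliffordAlgebra.contractLeft (Q := (0 : QuadraticForm R (Fin n → R)))
    (∑ i : Fin n, LinearMap.proj i)

theorem boundary_gen (R : Type*) [CommRing R] {n : ℕ} (i : Fin n) : boundary R (gen R i) = 1 := by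
  have h := CliffordAlgebra.contractLeft_ι (Q := (0 : QuadraticForm R (Fin n → R)))
    (∑ i : Fin n, LinearMap.proj i) (Pi.single i 1)
  refine h.trans ?_
  simp

theorem boundary_mul (R : Type*) [CommRing R] {n : ℕ} (p : ℕ) (a b : E R n)
    (ha : a ∈ ⋀[R]^p (Fin n → R)) :
    boundary R (a * b) = boundary R a * b + (-1) ^ p * (a * boundary R b) := by
  induction ha using Submodule.pow_induction_on_left' with
  | algebraMap r =>
    unfold boundary
    rw [CliffordAlgebra.contractLeft_algebraMap_mul, CliffordAlgebra.contractLeft_algebraMap]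
    simp only [zero_mul, pow_zero, one_mul, zero_add]
  | add x y i hx hy h₁ h₂ =>
    rw [add_mul, map_add, map_add, h₁, h₂, add_mul, add_mul, mul_add]
    abel
  | mem_mul m hm i x hx ih =>
    obtain ⟨v, rfl⟩ := hm
    have key : ∀ c : E R n, boundary R (ExteriorAlgebra.ι R v * c) =
        (∑ i : Fin n, LinearMap.proj (R := R) (φ := fun _ => R) i) v • c
          - ExteriorAlgebra.ι R v * boundary R c :=
      fun c => CliffordAlgebra.contractLeft_ι_mul _ v c
    have hc : ExteriorAlgebra.ι R v * (-1) ^ i = (-1) ^ i * ExteriorAlgebra.ι R v :=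
      ((Commute.neg_one_right _).pow_right i).eq
    rw [mul_assoc, key, ih, key, sub_mul, mul_add, ← mul_assoc _ ((-1 : E R n) ^ i), hc,
      smul_mul_assoc, pow_succ]
    simp only [mul_assoc, neg_mul, mul_neg, one_mul]
    abel

/-- The Orlik-Solomon ideal `I(M)` of `E`, generated by the elements `∂ e_S` for all dependent
sets `S` of `M`. -/
def osIdeal (R : Type*) [CommRing R] {n : ℕ} (M : Matroid (Fin n)) : TwoSidedIdeal (E R n) :=
  TwoSidedIdeal.span {x | ∃ S : Finset (Fin n), M.Dep (S : Set (Fin n)) ∧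
    x = boundary R (monomial R S)}

/-- A broken circuit is a circuit with its smallest element deleted. -/
def IsBrokenCircuit {n : ℕ} (M : Matroid (Fin n)) (B : Set (Fin n)) : Prop :=
  ∃ C ν, M.IsCircuit C ∧ IsLeast C ν ∧ B = C \ {ν}

/-- A set is nbc if it contains no broken circuit. -/
def IsNBC {n : ℕ} (M : Matroid (Fin n)) (T : Finset (Fin n)) : Prop :=
  ∀ B : Set (Fin n), IsBrokenCircuit M B → ¬ B ⊆ T

/-- The collection of the nbc sets whose cardinality is the rank of `M`. -/
def nbcBases {n : ℕ} (M : Matroid (Fin n)) : Set (Finset (Fin n)) :=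
  {T | IsNBC M T ∧ (T.card : ℕ∞) = M.eRank}

/-- The flat `X_p = cl {i_{ℓ-p+1}, …, i_ℓ}` spanned by the `p` largest elements of
`T = {i₁ < ⋯ < i_ℓ}`. -/
def flat {n : ℕ} (M : Matroid (Fin n)) (T : Finset (Fin n)) (p : ℕ) : Set (Fin n) :=
  M.closure {i | i ∈ T ∧ (T.filter (fun j => i < j)).card < p}

/-- The partition `π(T)` of the ground set into the sets `X_p \ X_{p-1}`, `1 ≤ p ≤ ℓ = |T|`. -/
def parts {n : ℕ} (M : Matroid (Fin n)) (T : Finset (Fin n)) : Set (Set (Fin n)) :=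
  {A | ∃ p < T.card, A = flat M T (p + 1) \ flat M T p}

/-- The ideal `I_T` of `E`, generated by the degree one elements `e_i - e_{ν(A)}` for all parts
`A` of `π(T)` and all `i ∈ A \ {ν(A)}`, where `ν(A)` is the smallest element of `A`. -/
def linearIdeal (R : Type*) [CommRing R] {n : ℕ} (M : Matroid (Fin n))
    (T : Finset (Fin n)) : TwoSidedIdeal (E R n) :=
  TwoSidedIdeal.span {x | ∃ A ∈ parts M T, ∃ ν, IsLeast A ν ∧ ∃ i ∈ A \ {ν},
    x = gen R i - gen R ν}

end OrlikSolomon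

end

/-! Inclusion `I ⊆ I_T`: a dependent set has two elements `i ≠ j` in one part of `π(T)`
(`exists_mem_parts_of_dep`), and then its boundary is a combination of multiples of `e_i - e_j`
(`boundary_monomial_mem`). Conversely, straightening along broken circuits shows that nbc monomials
span `E` modulo `I` (`monomial_mem_sup_span_nbc`). They are independent modulo `⋂ I_T`
(`eq_zero_of_mem_span_nbc`): sending each `e_i` to the generator of the minimum of its part kills
`I_T`, fixes `e_S` for `S ⊆ T`, and never raises index sums. Every nbc set lies in some `T` of full
rank, so a unitriangularity argument applies. Hence if `x = y + z` lies in every `I_T`, with `y ∈ I`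
and `z` an nbc combination, then `z` lies in every `I_T` too, so `z = 0`. -/

namespace OrlikSolomon

open Finset

/-! ### Monomials, coefficients and relabelings in the exterior algebra. -/

section Exterior

variable {R : Type*} [CommRing R] {n : ℕ}

theorem gen_mul_gen_self (i : Fin n) : gen R i * gen R i = 0 :=
  ExteriorAlgebra.ι_sq_zero _

theorem gen_mul_gen_swap (i j : Fin n) : gen R i * gen R j = -(gen R j * gen R i) :=
  eq_neg_of_add_eq_zero_left (ExteriorAlgebra.ι_add_mul_swap _ _)

/-- Permuting the factors of a product of generators changes it by a sign. -/
theorem prod_gen_perm {l l' : List (Fin n)} (h : l.Perm l') :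
    (l.map (gen R)).prod = (l'.map (gen R)).prod ∨
      (l.map (gen R)).prod = -(l'.map (gen R)).prod := by
  induction h with
  | nil => exact .inl rfl
  | cons x _ ih =>
    simp only [List.map_cons, List.prod_cons]
    rcases ih with h | h
    · exact .inl (by rw [h])
    · exact .inr (by rw [h, mul_neg])
  | swap x y l =>
    refine .inr ?_
    simp only [List.map_cons, List.prod_cons, ← mul_assoc]
    rw [gen_mul_gen_swap y x, neg_mul]
  | trans _ _ h₁ h₂ =>
    rcases h₁ with h₁ | h₁ <;> rcases h₂ with h₂ | h₂ <;> simp [h₁, h₂]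

theorem prod_gen_mem_of_perm {l l' : List (Fin n)} (h : l.Perm l') {A : Type*} [SetLike A (E R n)]
    [NegMemClass A (E R n)] {J : A} (hl : (l'.map (gen R)).prod ∈ J) :
    (l.map (gen R)).prod ∈ J := by
  rcases prod_gen_perm (R := R) h with h | h
  · rwa [h]
  · rw [h]; exact neg_mem hl

theorem sort_insert_perm {S : Finset (Fin n)} {i : Fin n} (hi : i ∉ S) :
    (insert i S).sort.Perm (i :: S.sort) := by
  refine (sort_perm_toList _ _).trans ((toList_insert hi).trans ?_)
  exact (sort_perm_toList _ _).symm.cons i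

theorem monomial_empty : monomial R (∅ : Finset (Fin n)) = 1 := by
  simp [monomial]

/-- A generator times a monomial is zero or, up to sign, a monomial. -/
theorem gen_mul_monomial_mem {i : Fin n} {S : Finset (Fin n)} {N : Submodule R (E R n)}
    (h : i ∉ S → monomial R (insert i S) ∈ N) : gen R i * monomial R S ∈ N := by
  by_cases hi : i ∈ S
  · have hp := prod_gen_perm (R := R) (sort_insert_perm (notMem_erase i S))
    rw [insert_erase hi, List.map_cons, List.prod_cons] at hp
    have h0 : gen R i * monomial R S = 0 := by
      unfold monomial
      rcases hp with hp | hp <;> simp [hp, ← mul_assoc, gen_mul_gen_self]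
    rw [h0]
    exact N.zero_mem
  · have := prod_gen_mem_of_perm (R := R) (sort_insert_perm hi).symm (h hi)
    simpa [monomial] using this

theorem ι_eq_sum_gen (v : Fin n → R) : ExteriorAlgebra.ι R v = ∑ i, v i • gen R i := by
  conv_lhs => rw [pi_eq_sum_univ' v]
  simp [gen]

theorem span_monomial : Submodule.span R (Set.range (monomial R (n := n))) = ⊤ := by
  refine eq_top_iff.2 fun x _ => ?_
  refine CliffordAlgebra.left_induction (Q := (0 : QuadraticForm R (Fin n → R)))
    (P := fun x => x ∈ Submodule.span R (Set.range (monomial R (n := n)))) ?_ ?_ ?_ x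
  · intro r
    rw [Algebra.algebraMap_eq_smul_one]
    exact Submodule.smul_mem _ _ (Submodule.subset_span ⟨∅, monomial_empty⟩)
  · exact fun _ _ => add_mem
  · intro x v hx
    change ExteriorAlgebra.ι R v * x ∈ _
    rw [ι_eq_sum_gen, sum_mul]
    refine sum_mem fun i _ => ?_
    rw [smul_mul_assoc]
    refine Submodule.smul_mem _ _ ?_
    suffices h : Submodule.span R (Set.range (monomial R (n := n))) ≤
        (Submodule.span R (Set.range (monomial R (n := n)))).comap
          (LinearMap.mulLeft R (gen R i)) from h hx
    refine Submodule.span_le.2 ?_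
    rintro _ ⟨S, rfl⟩
    exact gen_mul_monomial_mem fun _ => Submodule.subset_span (Set.mem_range_self _)

theorem boundary_gen_mul (i : Fin n) (x : E R n) :
    boundary R (gen R i * x) = x - gen R i * boundary R x := by
  have h := CliffordAlgebra.contractLeft_ι_mul (Q := (0 : QuadraticForm R (Fin n → R)))
    (∑ i : Fin n, LinearMap.proj i) (Pi.single i 1) x
  refine h.trans ?_
  simp [gen, boundary, ExteriorAlgebra.ι]

/-- The boundary of a product of generators is a combination of the products with one factor
deleted. -/
theorem boundary_prod_gen_mem {N : Submodule R (E R n)} {l : List (Fin n)}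
    (h : ∀ b ∈ l, ((l.erase b).map (gen R)).prod ∈ N) :
    boundary R (l.map (gen R)).prod ∈ N := by
  induction l generalizing N with
  | nil =>
    rw [List.map_nil, List.prod_nil, boundary, CliffordAlgebra.contractLeft_one]
    exact N.zero_mem
  | cons a l ih =>
    rw [List.map_cons, List.prod_cons, boundary_gen_mul]
    refine sub_mem (by simpa using h a (by simp)) ?_
    -- The remaining term keeps `e_a` on the left, so the induction runs with the preimage of `N`
    -- under multiplication by `e_a`.
    refine Submodule.mem_comap.1 (ih (N := N.comap (LinearMap.mulLeft R (gen R a)))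
      fun b hb => ?_)
    rw [Submodule.mem_comap, LinearMap.mulLeft_apply, ← List.prod_cons, ← List.map_cons]
    by_cases hab : a = b
    · subst hab
      exact prod_gen_mem_of_perm (List.perm_cons_erase hb).symm (by simpa using h a (by simp))
    · rw [← List.erase_cons_tail (by simpa using hab)]
      exact h b (by simp [hb])

theorem gen_mul_boundary_mul_mem {N : Submodule R (E R n)} {i : Fin n} {S : Finset (Fin n)}
    {y : E R n} (h : ∀ b ∈ S.sort, gen R i * ((S.sort.erase b).map (gen R)).prod * y ∈ N) :
    gen R i * boundary R (monomial R S) * y ∈ N :=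
  Submodule.mem_comap.1 (boundary_prod_gen_mem
    (N := N.comap (LinearMap.mulRight R y ∘ₗ LinearMap.mulLeft R (gen R i))) h)

/-- The coefficient of the monomial `e_{i₁} ⋯ e_{iₚ}`, as an iterated contraction. -/
def coeff (R : Type*) [CommRing R] {n : ℕ} : List (Fin n) → E R n →ₗ[R] R
  | [] => (ExteriorAlgebra.algebraMapInv (R := R) (M := Fin n → R)).toLinearMap
  | i :: l => coeff R l ∘ₗ CliffordAlgebra.contractLeft (Q := (0 : QuadraticForm R (Fin n → R)))
      (LinearMap.proj i)

theorem contract_gen_mul (i j : Fin n) (x : E R n) :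
    CliffordAlgebra.contractLeft (Q := (0 : QuadraticForm R (Fin n → R)))
      (LinearMap.proj i) (gen R j * x) = (if i = j then x else 0) -
        gen R j * CliffordAlgebra.contractLeft (Q := (0 : QuadraticForm R (Fin n → R)))
          (LinearMap.proj i) x := by
  have h := CliffordAlgebra.contractLeft_ι_mul (Q := (0 : QuadraticForm R (Fin n → R)))
    (LinearMap.proj i) (Pi.single j 1) x
  refine h.trans ?_
  by_cases hij : i = j <;> simp [gen, ExteriorAlgebra.ι, hij]

theorem contract_prod_gen_of_notMem {i : Fin n} {l : List (Fin n)} (hi : i ∉ l) :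
    CliffordAlgebra.contractLeft (R := R) (Q := (0 : QuadraticForm R (Fin n → R)))
      (LinearMap.proj i : (Fin n → R) →ₗ[R] R) ((l.map (gen R)).prod : E R n) = 0 := by
  induction l with
  | nil =>
    exact CliffordAlgebra.contractLeft_one (Q := (0 : QuadraticForm R (Fin n → R)))
      (LinearMap.proj i : (Fin n → R) →ₗ[R] R)
  | cons a l ih =>
    simp only [List.mem_cons, not_or] at hi
    rw [List.map_cons, List.prod_cons, contract_gen_mul, ih hi.2, if_neg hi.1]
    simp

theorem coeff_prod_gen_self {l : List (Fin n)} (hl : l.Nodup) :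
    coeff R l (l.map (gen R)).prod = 1 := by
  induction l with
  | nil => simp [coeff]
  | cons a l ih =>
    rw [List.nodup_cons] at hl
    rw [List.map_cons, List.prod_cons, coeff, LinearMap.comp_apply, contract_gen_mul,
      contract_prod_gen_of_notMem hl.1, if_pos rfl, mul_zero, sub_zero, ih hl.2]

theorem perm_of_coeff_prod_gen_ne_zero {l l' : List (Fin n)}
    (h : coeff R l (l'.map (gen R)).prod ≠ 0) : l'.Perm l := by
  induction l generalizing l' with
  | nil =>
    cases l' with
    | nil => exact .refl _
    | cons a l' => simp [coeff, gen, ExteriorAlgebra.algebraMapInv] at h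
  | cons a l ih =>
    rw [coeff, LinearMap.comp_apply] at h
    by_cases ha : a ∈ l'
    · refine (List.perm_cons_erase ha).trans ((ih fun h0 => h ?_).cons a)
      have key : coeff R l (CliffordAlgebra.contractLeft (Q := (0 : QuadraticForm R (Fin n → R)))
          (LinearMap.proj a) ((a :: l'.erase a).map (gen R)).prod) = 0 := by
        by_cases ha' : a ∈ l'.erase a
        · have hp := prod_gen_perm (R := R) (List.perm_cons_erase ha')
          have : ((a :: l'.erase a).map (gen R)).prod = 0 := by
            rw [List.map_cons, List.prod_cons]
            rcases hp with hp | hp <;> simp [hp, ← mul_assoc, gen_mul_gen_self]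
          rw [this, map_zero, map_zero]
        · rw [List.map_cons, List.prod_cons, contract_gen_mul, contract_prod_gen_of_notMem ha',
            if_pos rfl, mul_zero, sub_zero, h0]
      rcases prod_gen_perm (R := R) (List.perm_cons_erase ha) with hp | hp
      · rw [hp, key]
      · rw [hp, map_neg, map_neg, key, neg_zero]
    · exact absurd (by rw [contract_prod_gen_of_notMem ha, map_zero]) h

/-- The algebra endomorphism that sends `e_i` to `e_{τ i}`. -/
def relabel (R : Type*) [CommRing R] {n : ℕ} (τ : Fin n → Fin n) : E R n →ₐ[R] E R n :=
  ExteriorAlgebra.map (Fintype.linearCombination R fun i => (Pi.single (τ i) 1 : Fin n → R))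

theorem relabel_gen (τ : Fin n → Fin n) (i : Fin n) : relabel R τ (gen R i) = gen R (τ i) := by
  simp [relabel, gen, Fintype.linearCombination_apply_single]

theorem relabel_monomial (τ : Fin n → Fin n) (S : Finset (Fin n)) :
    relabel R τ (monomial R S) = ((S.sort.map τ).map (gen R)).prod := by
  simp only [monomial, map_list_prod, List.map_map]
  congr 2
  funext i
  exact relabel_gen τ i

/-- Up to sign the monomial is `e_i e_j y`, whose boundary is `-(e_i - e_j) y + (e_i - e_j) e_j ∂y`.
-/
theorem boundary_monomial_mem {J : TwoSidedIdeal (E R n)} {S : Finset (Fin n)} {i j : Fin n}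
    (hi : i ∈ S) (hj : j ∈ S) (hij : i ≠ j) (h : gen R i - gen R j ∈ J) :
    boundary R (monomial R S) ∈ J := by
  have hperm : S.sort.Perm (i :: j :: ((S.sort.erase i).erase j)) := by
    refine (List.perm_cons_erase (by simpa)).trans (List.Perm.cons _ (List.perm_cons_erase ?_))
    exact (List.mem_erase_of_ne hij.symm).2 (by simpa)
  have key : boundary R ((i :: j :: ((S.sort.erase i).erase j)).map (gen R)).prod ∈ J := by
    simp only [List.map_cons, List.prod_cons]
    generalize (((S.sort.erase i).erase j).map (gen R)).prod = y
    have e : boundary R (gen R i * (gen R j * y)) =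
        -((gen R i - gen R j) * y) + (gen R i - gen R j) * (gen R j * boundary R y) := by
      rw [boundary_gen_mul, boundary_gen_mul, sub_mul (gen R i) (gen R j) (_ * _),
        ← mul_assoc (gen R j) (gen R j), gen_mul_gen_self]
      noncomm_ring
    rw [e]
    exact J.add_mem (J.neg_mem (J.mul_mem_right _ _ h)) (J.mul_mem_right _ _ h)
  rcases prod_gen_perm (R := R) hperm with hp | hp
  · rw [monomial, hp]; exact key
  · rw [monomial, hp, map_neg]; exact J.neg_mem key

/-- The `R`-submodule underlying a two-sided ideal of the exterior algebra. -/
def idealSubmodule (J : TwoSidedIdeal (E R n)) : Submodule R (E R n) :=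
  J.asIdeal.restrictScalars R

theorem mem_idealSubmodule {J : TwoSidedIdeal (E R n)} {x : E R n} :
    x ∈ idealSubmodule J ↔ x ∈ J := by
  simp [idealSubmodule]

end Exterior

/-! ### Nbc sets, the flag of flats and the minima of the parts. -/

section Matroid

variable {n : ℕ} {M : Matroid (Fin n)} {T : Finset (Fin n)}

theorem exists_isLeast_fin {A : Set (Fin n)} (hA : A.Nonempty) : ∃ ν, IsLeast A ν :=
  ⟨_, (A.toFinite).isWF.min_mem hA, fun _ h => (A.toFinite).isWF.min_le hA h⟩

theorem IsNBC.indep (hE : M.E = Set.univ) (hT : IsNBC M T) : M.Indep (T : Set (Fin n)) := by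
  rw [Matroid.indep_iff_forall_subset_not_isCircuit (by simp [hE])]
  intro C hCT hC
  obtain ⟨ν, hν⟩ := exists_isLeast_fin hC.nonempty
  exact hT _ ⟨C, ν, hC, hν, rfl⟩ (Set.sdiff_subset.trans hCT)

theorem isBase_of_mem_nbcBases (hE : M.E = Set.univ) (hT : T ∈ nbcBases M) :
    M.IsBase (T : Set (Fin n)) := by
  refine (hT.1.indep hE).isBase_of_eRk_ge T.finite_toSet ?_
  rw [(hT.1.indep hE).eRk_eq_encard, ← hT.2, Set.encard_coe_eq_coe_finsetCard]

/-- A new broken circuit `C \ {ν}` must contain `i`, so `ν < i` and minimality of `i` puts `ν` in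
the closure of `T`. The rest of `C` then spans `i`, a contradiction. -/
theorem IsNBC.insert_isLeast (hT : IsNBC M T) {i : Fin n}
    (hi : IsLeast (M.closure (T : Set (Fin n)))ᶜ i) : IsNBC M (insert i T) := by
  rintro B ⟨C, ν, hC, hν, rfl⟩ hB
  have hiC : i ∈ C \ {ν} := by
    by_contra h
    refine hT _ ⟨C, ν, hC, hν, rfl⟩ fun x hx => ?_
    rcases mem_insert.1 (hB hx) with rfl | hxT
    · exact absurd hx h
    · exact hxT
  have hνi : ν < i := lt_of_le_of_ne (hν.2 hiC.1) (Ne.symm hiC.2)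
  have hνT : ν ∈ M.closure (T : Set (Fin n)) := by
    by_contra h
    exact absurd (hi.2 h) (not_le.2 hνi)
  refine hi.1 (M.closure_subset_closure_of_subset_closure (X := C \ {i}) ?_
    (hC.mem_closure_sdiff_singleton_of_mem hiC.1))
  rintro x ⟨hxC, hxi⟩
  by_cases hx : x = ν
  · rwa [hx]
  · rcases mem_insert.1 (hB ⟨hxC, hx⟩) with rfl | hxT
    · exact absurd rfl hxi
    · exact M.mem_closure_of_mem' hxT (hC.subset_ground hxC)

/-- The nbc complex is pure: every nbc set is contained in one of maximal cardinality. -/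
theorem IsNBC.exists_superset_mem_nbcBases (hE : M.E = Set.univ) {S : Finset (Fin n)}
    (hS : IsNBC M S) : ∃ T ∈ nbcBases M, S ⊆ T := by
  obtain ⟨T, hST, hT⟩ := (Set.toFinite {T : Finset (Fin n) | IsNBC M T}).exists_le_maximal hS
  refine ⟨T, ⟨hT.prop, ?_⟩, hST⟩
  rw [← Set.encard_coe_eq_coe_finsetCard]
  refine ((hT.prop.indep hE).isBase_of_ground_subset_closure ?_).encard_eq_eRank
  by_contra h
  have hne : (M.closure (T : Set (Fin n)))ᶜ.Nonempty := by
    obtain ⟨x, -, hx⟩ := Set.not_subset.1 h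
    exact ⟨x, hx⟩
  obtain ⟨i, hi⟩ := exists_isLeast_fin hne
  have hiT := hT.le_of_ge (y := insert i T) (hT.prop.insert_isLeast hi) (subset_insert _ _)
  exact hi.1 (M.mem_closure_of_mem' (hiT (mem_insert_self _ _)) (by simp [hE]))

theorem flat_mono {p q : ℕ} (h : p ≤ q) : flat M T p ⊆ flat M T q :=
  M.closure_subset_closure fun _ hi => ⟨hi.1, hi.2.trans_le h⟩

theorem flat_card (hE : M.E = Set.univ) (hT : M.IsBase (T : Set (Fin n))) :
    flat M T T.card = Set.univ := by
  have : {i | i ∈ T ∧ (T.filter (fun j => i < j)).card < T.card} = (T : Set (Fin n)) := by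
    ext i
    refine ⟨fun h => h.1, fun h => ⟨h, card_lt_card (filter_ssubset.2 ⟨i, h, lt_irrefl i⟩)⟩⟩
  rw [flat, this, hT.closure_eq, hE]

theorem flat_zero (hE : M.E = Set.univ) (hM : IsSimple M) : flat M T 0 = ∅ := by
  refine Set.eq_empty_of_forall_notMem fun i hi => ?_
  have h : M.Indep {i} := by simpa using hM i (by simp [hE]) i (by simp [hE])
  simp only [flat, not_lt_zero, and_false, Set.ofPred_false] at hi
  exact (Matroid.indep_singleton.1 h).not_isLoop hi

theorem exists_mem_flat_sdiff (hE : M.E = Set.univ) (hM : IsSimple M)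
    (hT : M.IsBase (T : Set (Fin n))) (i : Fin n) :
    ∃ p < T.card, i ∈ flat M T (p + 1) \ flat M T p := by
  by_contra! h
  have : ∀ p ≤ T.card, i ∉ flat M T p := by
    intro p
    induction p with
    | zero => simp [flat_zero hE hM]
    | succ p ih => exact fun hp hi => h p hp ⟨hi, ih (by lia)⟩
  exact this _ le_rfl (by simp [flat_card hE hT])

/-- A dependent set has two distinct elements in the same part of `π(T)`. -/
theorem exists_mem_parts_of_dep (hE : M.E = Set.univ) (hM : IsSimple M)
    (hT : M.IsBase (T : Set (Fin n))) {S : Set (Fin n)} (hS : M.Dep S) :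
    ∃ A ∈ parts M T, ∃ i ∈ S, ∃ j ∈ S, i ≠ j ∧ i ∈ A ∧ j ∈ A := by
  choose lev hlt hlev using exists_mem_flat_sdiff hE hM hT
  obtain ⟨C, hCS, hC⟩ := hS.exists_isCircuit_subset
  -- If no other element of `C` shares the top level, then `C \ {i}` lies in a smaller flat, which
  -- would contain `i`.
  obtain ⟨i, hi, hmax⟩ := C.toFinite.exists_maximalFor lev C hC.nonempty
  by_cases h : ∃ j ∈ C, i ≠ j ∧ lev i = lev j
  · obtain ⟨j, hj, hij, hl⟩ := h
    exact ⟨_, ⟨lev i, hlt i, rfl⟩, i, hCS hi, j, hCS hj, hij, hlev i, hl ▸ hlev j⟩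
  · push Not at h
    refine absurd ?_ (hlev i).2
    refine M.closure_subset_closure_of_subset_closure (X := C \ {i}) ?_
      (hC.mem_closure_sdiff_singleton_of_mem hi)
    rintro j ⟨hj, hji⟩
    have h1 := h j hj (Ne.symm hji)
    have h2 : lev j < lev i := by
      rcases lt_or_ge (lev j) (lev i) with h' | h'
      · exact h'
      · exact absurd (le_antisymm h' (hmax hj h')) h1
    exact flat_mono h2 (hlev j).1

open Classical in
/-- The smallest element of the part of `π(T)` that contains `i`. -/
noncomputable def partMin (M : Matroid (Fin n)) (T : Finset (Fin n)) (i : Fin n) : Fin n :=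
  -- Membership in the same flats replaces membership in a common part, so the minimum exists for
  -- every `i` and every `T`.
  (univ.filter fun j => ∀ p, j ∈ flat M T p ↔ i ∈ flat M T p).min' ⟨i, by simp⟩

theorem partMin_le (i : Fin n) : partMin M T i ≤ i :=
  min'_le _ _ (by simp)

theorem partMin_mem_flat_iff {i : Fin n} (p : ℕ) :
    partMin M T i ∈ flat M T p ↔ i ∈ flat M T p := by
  classical
  have := min'_mem (univ.filter fun j => ∀ p, j ∈ flat M T p ↔ i ∈ flat M T p) ⟨i, by simp⟩
  exact (mem_filter.1 this).2 p

theorem partMin_eq_of_mem_parts {A : Set (Fin n)} (hA : A ∈ parts M T) {i j : Fin n}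
    (hi : i ∈ A) (hj : j ∈ A) : partMin M T i = partMin M T j := by
  obtain ⟨p, -, rfl⟩ := hA
  have h : ∀ q, i ∈ flat M T q ↔ j ∈ flat M T q := by
    intro q
    rcases le_or_gt q p with hq | hq
    · exact iff_of_false (fun h => hi.2 (flat_mono hq h)) (fun h => hj.2 (flat_mono hq h))
    · exact iff_of_true (flat_mono hq hi.1) (flat_mono hq hj.1)
  unfold partMin
  congr 1
  ext k
  simp only [mem_filter, h]

/-- A smaller element of the part of `t` would be spanned by the elements of `T` that are at least
`t`. It would be the least element of a circuit whose remaining elements lie in `T`, giving a broken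
circuit in `T`. -/
theorem IsNBC.partMin_eq_self (hE : M.E = Set.univ) (hT : IsNBC M T) {t : Fin n} (ht : t ∈ T) :
    partMin M T t = t := by
  refine le_antisymm (partMin_le t) (le_of_not_gt fun hlt => ?_)
  -- The `+ 1` makes `t` itself a member; an `x < t` in `T` has too many elements above it.
  set X : Set (Fin n) :=
    {i | i ∈ T ∧ (T.filter (fun j => i < j)).card < (T.filter (fun j => t < j)).card + 1}
  have hX : ∀ x ∈ X, t ≤ x := by
    intro x hx
    by_contra! hxt
    refine absurd hx.2 (not_lt.2 (Nat.succ_le_of_lt (card_lt_card ?_)))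
    refine (ssubset_iff_of_subset fun j hj => ?_).2 ⟨t, by simp [ht, hxt], by simp⟩
    rw [mem_filter] at hj ⊢
    exact ⟨hj.1, hxt.trans hj.2⟩
  have hmem : partMin M T t ∈ M.closure X :=
    (partMin_mem_flat_iff (M := M) (T := T) (i := t) ((T.filter (fun j => t < j)).card + 1)).2
      (M.mem_closure_of_mem' ⟨ht, Nat.lt_succ_self _⟩ (by simp [hE]))
  obtain ⟨C, hCX, hC, hmC⟩ :=
    Matroid.exists_isCircuit_of_mem_closure hmem fun h => absurd (hX _ h) (not_le.2 hlt)
  refine hT _ ⟨C, partMin M T t, hC, ⟨hmC, fun x hx => ?_⟩, rfl⟩ fun x hx => ?_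
  · rcases hCX hx with rfl | hx
    · exact le_rfl
    · exact hlt.le.trans (hX x hx)
  · rcases hCX hx.1 with h | h
    · exact absurd h hx.2
    · exact h.1

end Matroid

/-! ### Comparison of the Orlik–Solomon ideal with the linear ideals. -/

section Ideals

variable {R : Type*} [CommRing R] {n : ℕ} {M : Matroid (Fin n)} {T : Finset (Fin n)}

theorem gen_sub_gen_mem_linearIdeal {A : Set (Fin n)} (hA : A ∈ parts M T) {i j : Fin n}
    (hi : i ∈ A) (hj : j ∈ A) : gen R i - gen R j ∈ linearIdeal R M T := by
  obtain ⟨ν, hν⟩ := exists_isLeast_fin ⟨i, hi⟩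
  have h : ∀ k ∈ A, gen R k - gen R ν ∈ linearIdeal R M T := by
    intro k hk
    by_cases hkν : k = ν
    · rw [hkν, sub_self]; exact TwoSidedIdeal.zero_mem _
    · exact TwoSidedIdeal.subset_span ⟨A, hA, ν, hν, k, ⟨hk, hkν⟩, rfl⟩
  simpa using TwoSidedIdeal.sub_mem _ (h i hi) (h j hj)

theorem osIdeal_le_linearIdeal (hE : M.E = Set.univ) (hM : IsSimple M)
    (hT : M.IsBase (T : Set (Fin n))) : osIdeal R M ≤ linearIdeal R M T := by
  refine TwoSidedIdeal.span_le.2 ?_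
  rintro _ ⟨S, hS, rfl⟩
  obtain ⟨A, hA, i, hi, j, hj, hij, hiA, hjA⟩ := exists_mem_parts_of_dep hE hM hT hS
  exact boundary_monomial_mem hi hj hij (gen_sub_gen_mem_linearIdeal hA hiA hjA)

theorem relabel_eq_zero_of_mem_linearIdeal {x : E R n} (hx : x ∈ linearIdeal R M T) :
    relabel R (partMin M T) x = 0 := by
  suffices h : linearIdeal R M T ≤ TwoSidedIdeal.ker (relabel R (partMin M T)) from
    (TwoSidedIdeal.mem_ker _).1 (h hx)
  refine TwoSidedIdeal.span_le.2 ?_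
  rintro _ ⟨A, hA, ν, hν, i, hi, rfl⟩
  refine (TwoSidedIdeal.mem_ker _).2 ?_
  rw [map_sub, relabel_gen, relabel_gen, partMin_eq_of_mem_parts hA hi.1 hν.1, sub_self]

/-- For `i ∈ S`, applying `∂` to `e_i e_S = 0` gives `e_S = e_i ∂e_S`. -/
theorem monomial_mem_osIdeal {S : Finset (Fin n)} (hS : M.Dep (S : Set (Fin n))) :
    monomial R S ∈ osIdeal R M := by
  obtain ⟨i, hi⟩ := hS.nonempty
  have h0 : gen R i * monomial R S = 0 := by
    simpa using gen_mul_monomial_mem (R := R) (N := ⊥) (i := i) (S := S) fun h => absurd hi h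
  have h := boundary_gen_mul i (monomial R S)
  rw [h0, map_zero, eq_comm, sub_eq_zero] at h
  rw [h]
  exact TwoSidedIdeal.mul_mem_left _ _ _ (TwoSidedIdeal.subset_span ⟨S, hS, rfl⟩)

/-- Modulo the Orlik-Solomon ideal, every monomial is a combination of nbc monomials. -/
theorem monomial_mem_sup_span_nbc (hE : M.E = Set.univ) (S : Finset (Fin n)) :
    monomial R S ∈ idealSubmodule (osIdeal R M) ⊔
      Submodule.span R (monomial R '' {S | IsNBC M S}) := by
  -- Straightening replaces some `b` in the broken circuit by the smaller `ν`, so the index sum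
  -- decreases.
  induction hs : ∑ i ∈ S, (i : ℕ) using Nat.strong_induction_on generalizing S with
  | _ s ih =>
  subst hs
  by_cases hS : IsNBC M S
  · exact Submodule.mem_sup_right (Submodule.subset_span ⟨S, hS, rfl⟩)
  simp only [IsNBC, not_forall, not_not] at hS
  obtain ⟨_, ⟨C, ν, hC, hν, rfl⟩, hCS⟩ := hS
  by_cases hνS : ν ∈ S
  · refine Submodule.mem_sup_left (mem_idealSubmodule.2 (monomial_mem_osIdeal
      (hC.dep.superset (fun x hx => ?_) (by simp [hE]))))
    by_cases hxν : x = ν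
    · rwa [hxν]
    · exact hCS ⟨hx, hxν⟩
  obtain ⟨B, hB⟩ : ∃ B : Finset (Fin n), (B : Set (Fin n)) = C \ {ν} :=
    ⟨_, (Set.toFinite (C \ {ν})).coe_toFinset⟩
  have hmemB : ∀ b, b ∈ B ↔ b ∈ C ∧ b ≠ ν := fun b => by
    rw [← mem_coe, hB]; simp
  have hBS : B ⊆ S := fun b hb => hCS (hB ▸ hb)
  have hνB : ν ∉ B := fun h => ((hmemB ν).1 h).2 rfl
  have hCB : monomial R (insert ν B) = gen R ν * monomial R B := by
    rw [monomial, sort_insert _ (fun b hb => hν.2 ((hmemB b).1 hb).1) hνB]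
    simp [monomial]
  have hcirc : boundary R (monomial R (insert ν B)) ∈ osIdeal R M := by
    refine TwoSidedIdeal.subset_span ⟨insert ν B, ?_, rfl⟩
    rw [coe_insert, hB, Set.insert_sdiff_singleton, Set.insert_eq_of_mem hν.1]
    exact hC.dep
  have hperm : S.sort.Perm (B.sort ++ (S \ B).sort) := by
    refine (List.perm_ext_iff_of_nodup (sort_nodup _ _) (List.nodup_append'.2
      ⟨sort_nodup _ _, sort_nodup _ _, fun x hx hx' => ?_⟩)).2 fun x => ?_
    · rw [mem_sort] at hx hx'
      exact (mem_sdiff.1 hx').2 hx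
    · simp only [List.mem_append, mem_sort, mem_sdiff]
      have := @hBS x
      tauto
  refine prod_gen_mem_of_perm (R := R) hperm (J := idealSubmodule (osIdeal R M) ⊔
    Submodule.span R (monomial R '' {S | IsNBC M S})) ?_
  rw [List.map_append, List.prod_append]
  change monomial R B * monomial R (S \ B) ∈ _
  -- This is the Leibniz rule for `e_ν e_B`: modulo `I`, `e_B` becomes `e_ν ∂e_B`.
  have hsplit : monomial R B =
      boundary R (monomial R (insert ν B)) + gen R ν * boundary R (monomial R B) := by
    rw [hCB, boundary_gen_mul]; abel
  rw [hsplit, add_mul]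
  refine add_mem (Submodule.mem_sup_left
    (mem_idealSubmodule.2 (TwoSidedIdeal.mul_mem_right _ _ _ hcirc))) ?_
  refine gen_mul_boundary_mul_mem fun b hb => ?_
  rw [mem_sort] at hb
  have hνb : ν < b := lt_of_le_of_ne (hν.2 ((hmemB b).1 hb).1) (Ne.symm ((hmemB b).1 hb).2)
  have hperm' : (ν :: (B.sort.erase b ++ (S \ B).sort)).Perm (insert ν (S.erase b)).sort := by
    have hmem : ∀ x, x ∈ B.sort.erase b ++ (S \ B).sort ↔ x ∈ S.erase b := fun x => by
      simp only [List.mem_append, (sort_nodup B _).mem_erase_iff, mem_sort, mem_sdiff, mem_erase]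
      have := @hBS x
      have : x = b → x ∈ B := fun h => h ▸ hb
      tauto
    refine (List.perm_ext_iff_of_nodup (List.nodup_cons.2 ⟨fun h => ?_, List.nodup_append'.2
      ⟨(sort_nodup _ _).erase _, sort_nodup _ _, fun x hx hx' => ?_⟩⟩) (sort_nodup _ _)).2
        fun x => ?_
    · exact hνS (mem_of_mem_erase ((hmem ν).1 h))
    · exact (mem_sdiff.1 ((mem_sort _).1 hx')).2 ((mem_sort _).1 (List.mem_of_mem_erase hx))
    · rw [List.mem_cons, hmem, mem_sort, mem_insert]
  have hsum : ∑ i ∈ insert ν (S.erase b), (i : ℕ) < ∑ i ∈ S, (i : ℕ) := by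
    rw [sum_insert fun h => hνS (mem_of_mem_erase h), ← add_sum_erase S _ (hBS hb)]
    exact Nat.add_lt_add_right hνb _
  have h := prod_gen_mem_of_perm (R := R) hperm' (ih _ hsum _ rfl)
  rw [List.map_cons, List.prod_cons, List.map_append, List.prod_append, ← mul_assoc] at h
  exact h

/-- For an nbc set `S` contained in an nbc base `T`, the coefficient of `e_S` modulo `I_T` is
unitriangular on monomials with respect to the sum of the elements. -/
theorem coeff_relabel_monomial_self (hE : M.E = Set.univ) (hT : IsNBC M T) {S : Finset (Fin n)}
    (hST : S ⊆ T) : coeff R S.sort (relabel R (partMin M T) (monomial R S)) = 1 := by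
  have : S.sort.map (partMin M T) = S.sort := by
    conv_rhs => rw [← List.map_id (S.sort (· ≤ ·))]
    exact List.map_congr_left fun t ht => hT.partMin_eq_self hE (hST ((mem_sort _).1 ht))
  rw [relabel_monomial, this, coeff_prod_gen_self (sort_nodup _ _)]

/-- A nonzero coefficient means that `partMin` carries `S'` bijectively onto `S`. Since it never
increases an index, the sum drops strictly unless every element is fixed. -/
theorem eq_or_sum_lt_of_coeff_relabel_ne_zero {S S' : Finset (Fin n)}
    (h : coeff R S.sort (relabel R (partMin M T) (monomial R S')) ≠ 0) :
    S' = S ∨ ∑ i ∈ S, (i : ℕ) < ∑ i ∈ S', (i : ℕ) := by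
  rw [relabel_monomial] at h
  have hp := perm_of_coeff_prod_gen_ne_zero h
  have hS : S = S'.image (partMin M T) := by
    ext x
    rw [← mem_sort (s := S) (· ≤ ·), ← hp.mem_iff]
    simp
  have hsum : ∑ i ∈ S', (partMin M T i : ℕ) = ∑ i ∈ S, (i : ℕ) := by
    have h1 := (hp.map (fun i : Fin n => (i : ℕ))).sum_eq
    have h2 : ∀ (A : Finset (Fin n)) (f : Fin n → ℕ), (A.sort.map f).sum = ∑ i ∈ A, f i := by
      intro A f
      rw [((sort_perm_toList A (· ≤ ·)).map f).sum_eq, sum_map_toList]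
    rw [List.map_map, h2, h2] at h1
    exact h1
  by_cases hfix : ∀ i ∈ S', partMin M T i = i
  · refine .inl ?_
    rw [hS, image_congr (g := id) fun i hi => hfix i hi, image_id]
  · push Not at hfix
    obtain ⟨i, hi, hne⟩ := hfix
    refine .inr (hsum ▸ sum_lt_sum (fun j _ => partMin_le j) ⟨i, hi, ?_⟩)
    exact lt_of_le_of_ne (partMin_le i) (Fin.val_ne_of_ne hne)

/-- The nbc monomials are linearly independent modulo the intersection of the linear ideals. -/
theorem eq_zero_of_mem_span_nbc (hE : M.E = Set.univ) {z : E R n}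
    (hz : z ∈ Submodule.span R (monomial R '' {S | IsNBC M S}))
    (hzT : ∀ T ∈ nbcBases M, z ∈ linearIdeal R M T) : z = 0 := by
  obtain ⟨c, hc, rfl⟩ := (Finsupp.mem_span_image_iff_linearCombination R).1 hz
  suffices h : c = 0 by rw [h, map_zero]
  by_contra hne
  -- With `S` of maximal sum in the support, no other term contributes to the coefficient of `e_S`
  -- after relabeling.
  obtain ⟨S, hS, hmax⟩ := c.support.exists_max_image (fun S => ∑ i ∈ S, (i : ℕ))
    (Finsupp.support_nonempty_iff.2 hne)
  have hSnbc : IsNBC M S := hc hS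
  obtain ⟨T, hT, hST⟩ := hSnbc.exists_superset_mem_nbcBases hE
  have h0 := congrArg (coeff R S.sort) (relabel_eq_zero_of_mem_linearIdeal (hzT T hT))
  rw [map_zero, Finsupp.linearCombination_apply, Finsupp.sum, map_sum, map_sum,
    sum_eq_single_of_mem S hS, map_smul, map_smul, coeff_relabel_monomial_self hE hT.1 hST,
    smul_eq_mul, mul_one] at h0
  · exact Finsupp.mem_support_iff.1 hS h0
  · intro S' hS' hS'S
    rw [map_smul, map_smul]
    by_contra h
    rcases eq_or_sum_lt_of_coeff_relabel_ne_zero (right_ne_zero_of_smul h) with h | h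
    · exact hS'S h
    · exact absurd (hmax S' hS') (not_le.2 h)

end Ideals

end OrlikSolomon

/-- The Orlik-Solomon ideal of a simple matroid on `[n]` is the intersection of the linear
ideals `I_T`, where `T` runs over the nbc sets of maximal cardinality. -/
theorem corollary3p6 (R : Type*) [CommRing R] (n : ℕ) (M : Matroid (Fin n))
    (hE : M.E = Set.univ) (hM : OrlikSolomon.IsSimple M) :
    OrlikSolomon.osIdeal R M =
      ⨅ T ∈ OrlikSolomon.nbcBases M, OrlikSolomon.linearIdeal R M T := by
  refine le_antisymm (le_iInf₂ fun T hT => OrlikSolomon.osIdeal_le_linearIdeal hE hM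
    (OrlikSolomon.isBase_of_mem_nbcBases hE hT)) fun x hx => ?_
  have hxT : ∀ T ∈ OrlikSolomon.nbcBases M, x ∈ OrlikSolomon.linearIdeal R M T := by
    exact fun T hT => iInf₂_le (f := fun T (_ : T ∈ OrlikSolomon.nbcBases M) =>
      OrlikSolomon.linearIdeal R M T) T hT hx
  have hx' : x ∈ OrlikSolomon.idealSubmodule (OrlikSolomon.osIdeal R M) ⊔
      Submodule.span R (OrlikSolomon.monomial R '' {S | OrlikSolomon.IsNBC M S}) := by
    have h : x ∈ Submodule.span R (Set.range (OrlikSolomon.monomial R (n := n))) := by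
      rw [OrlikSolomon.span_monomial]; trivial
    refine (Submodule.span_le.2 ?_) h
    rintro _ ⟨S, rfl⟩
    exact OrlikSolomon.monomial_mem_sup_span_nbc hE S
  obtain ⟨y, hy, z, hz, rfl⟩ := Submodule.mem_sup.1 hx'
  rw [OrlikSolomon.mem_idealSubmodule] at hy
  have hz0 : z = 0 := OrlikSolomon.eq_zero_of_mem_span_nbc hE hz fun T hT => by
    have hyT := OrlikSolomon.osIdeal_le_linearIdeal hE hM
      (OrlikSolomon.isBase_of_mem_nbcBases hE hT) hy
    simpa using TwoSidedIdeal.sub_mem _ (hxT T hT) hyT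
  rwa [hz0, add_zero]
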